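/- Let $p,n$ be natural numbers, let $X$ be a real $n\times p$ data matrix with columns $X_1,\dots,X_p$, and for $S\subseteq[p]=\{1,\dots,p\}$ let $X_S$ be the submatrix of $X$ with columns indexed by $S$. Let $c_1>0$, $c_2\ge 0$, $\alpha\in(0,1)$, $\gamma>0$, $\kappa\ge 0$. For a directed acyclic graph (DAG) $G$ with vertex set $[p]$, let $\mathrm{Pa}_j(G)$ be the set of parents of node $j$, and define the empirical Bayes posterior score by \[ \psi(G)=\sum_{j=1}^p \psi_j(\mathrm{Pa}_j(G)),\qquad e^{\psi_j(S)}=\Bigl\{c_1p^{c_2}\sqrt{1+\tfrac{\alpha}{\gamma}}\Bigr\}^{-|S|}\Bigl\{X_j^\top\bigl(I-X_S(X_S^\top X_S)^{-1}X_S^\top\bigr)X_j\Bigr\}^{-(\alpha n+\kappa)/2}. \] We say that $\psi(G)$ is well defined if for every $j$, with $S=\mathrm{Pa}_j(G)$, the matrix $X_S^\top X_S$ is invertible and $X_j^\top(I-X_S(X_S^\top X_S)^{-1}X_S^\top)X_j>0$. Two DAGs $G,G'$ on $[p]$ are Markov equivalent if they encode the same conditional independence relations, i.e. for all pairwise disjoint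 $A,B,C\subseteq[p]$, the sets $A$ and $B$ are d-separated by $C$ in $G$ if and only if they are d-separated by $C$ in $G'$. If $G$ and $G'$ are Markov equivalent DAGs on $[p]$ and $\psi(G)$ is well defined, then $\psi(G')$ is well defined and $\psi(G)=\psi(G')$. -/

import Mathlib

/-- A directed acyclic graph with vertex set `Fin p`; `G.Adj i j` means `i → j ∈ G`. -/
structure DAG (p : ℕ) extends Digraph (Fin p) where
  acyclic : ∀ i, ¬ Relation.TransGen Adj i i

namespace DAG

variable {p : ℕ}

open Classical in
/-- The parent set `Pa_j(G)`. -/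
noncomputable def parents (G : DAG p) (j : Fin p) : Finset (Fin p) :=
  Finset.univ.filter fun i => G.Adj i j

/-- The undirected graph obtained by forgetting the orientation of the edges. -/
def skeleton (G : DAG p) : SimpleGraph (Fin p) :=
  G.toDigraph.toSimpleGraphInclusive

/-- The node at position `k` of the walk `w` is a collider: both neighbouring edges of the walk
point into it. -/
def IsColliderAt (G : DAG p) {a b : Fin p} (w : G.skeleton.Walk a b) (k : ℕ) : Prop :=
  G.Adj (w.getVert (k - 1)) (w.getVert k) ∧ G.Adj (w.getVert (k + 1)) (w.getVert k)

/-- The path `w` is blocked by `C`: it has an interior node which is either a non-collider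
belonging to `C`, or a collider such that neither it nor any of its descendants belongs to `C`. -/
def Blocks (G : DAG p) (C : Finset (Fin p)) {a b : Fin p} (w : G.skeleton.Walk a b) : Prop :=
  ∃ k, 0 < k ∧ k < w.length ∧
    ((¬ G.IsColliderAt w k ∧ w.getVert k ∈ C) ∨
      (G.IsColliderAt w k ∧ ∀ d, Relation.ReflTransGen G.Adj (w.getVert k) d → d ∉ C))

/-- `A` and `B` are d-separated by `C`: every path between `A` and `B` is blocked by `C`. -/
def DSep (G : DAG p) (A B C : Finset (Fin p)) : Prop :=
  ∀ a ∈ A, ∀ b ∈ B, ∀ w : G.skeleton.Walk a b, w.IsPath → G.Blocks C w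

/-- The set of conditional independence relations `A ⫫ B | C` (with `A`, `B`, `C` pairwise
disjoint) encoded by `G`, read off by d-separation. -/
def CI (G : DAG p) : Set (Finset (Fin p) × Finset (Fin p) × Finset (Fin p)) :=
  {t | Disjoint t.1 t.2.1 ∧ Disjoint t.1 t.2.2 ∧ Disjoint t.2.1 t.2.2 ∧ G.DSep t.1 t.2.1 t.2.2}

/-- Markov equivalence: both graphs encode the same conditional independence relations. -/
def MarkovEquiv (G G' : DAG p) : Prop := G.CI = G'.CI

end DAG

namespace EmpiricalBayes

open Matrix

variable {n p : ℕ}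

/-- The submatrix `X_S` of the columns of the data matrix indexed by `S`. -/
def colSub (X : Matrix (Fin n) (Fin p) ℝ) (S : Finset (Fin p)) : Matrix (Fin n) S ℝ :=
  X.submatrix id (fun i : S => (i : Fin p))

/-- The matrix `Φ_S = X_S (X_Sᵀ X_S)⁻¹ X_Sᵀ`. -/
noncomputable def proj (X : Matrix (Fin n) (Fin p) ℝ) (S : Finset (Fin p)) :
    Matrix (Fin n) (Fin n) ℝ :=
  colSub X S * ((colSub X S)ᵀ * colSub X S)⁻¹ * (colSub X S)ᵀ

/-- The residual sum of squares `X_jᵀ (I - Φ_S) X_j`. -/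
noncomputable def rss (X : Matrix (Fin n) (Fin p) ℝ) (j : Fin p) (S : Finset (Fin p)) : ℝ :=
  X.col j ⬝ᵥ ((1 - proj X S) *ᵥ X.col j)

/-- The local posterior score `ψ_j(S)`, the logarithm of
`(c₁ p^{c₂} √(1 + α/γ))^{-|S|} (X_jᵀ (I - Φ_S) X_j)^{-(α n + κ)/2}`. -/
noncomputable def localScore (c₁ c₂ α γ κ : ℝ) (X : Matrix (Fin n) (Fin p) ℝ)
    (j : Fin p) (S : Finset (Fin p)) : ℝ :=
  Real.log ((c₁ * (p : ℝ) ^ c₂ * √(1 + α / γ)) ^ (-(S.card : ℤ)) *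
    (rss X j S) ^ (-(α * n + κ) / 2))

/-- The posterior score `ψ(G) = ∑_j ψ_j(Pa_j(G))`. -/
noncomputable def score (c₁ c₂ α γ κ : ℝ) (X : Matrix (Fin n) (Fin p) ℝ) (G : DAG p) : ℝ :=
  ∑ j, localScore c₁ c₂ α γ κ X j (G.parents j)

/-- The expression for `ψ(G)` makes sense for the data `X`: for every node `j` the Gram matrix of
the parents of `j` is invertible and the residual sum of squares is positive. -/
def ScoreDefined (X : Matrix (Fin n) (Fin p) ℝ) (G : DAG p) : Prop :=
  ∀ j, IsUnit ((colSub X (G.parents j))ᵀ * colSub X (G.parents j)) ∧ 0 < rss X j (G.parents j)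

end EmpiricalBayes

/-! Since `rss X j S` is a Schur complement, each local score is an increment `F (insert j S) - F S`
of one set function (`potential`): a multiple of the log Gram determinant, minus a binomial term for
the penalty. Writing `F T` as a sum of `g S` over `S ⊆ T`, the total score becomes the sum of `g S`
over the sets `S` that have a sink (`sum_insert_parents_sub`). Markov equivalent graphs share
skeleton and v-structures, hence these sets (`MarkovEquiv.exists_isSinkOf`). Thus also every family
(a node with its parents) of `G'` lies inside a family of `G`, so positivity of Gram determinants
passes to `G'`. -/

/-! ### d-separation, skeletons and v-structures -/

namespace DAG

variable {p : ℕ} {G G' : DAG p}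

lemma mem_parents {i j : Fin p} : i ∈ G.parents j ↔ G.Adj i j := by
  simp [parents]

lemma ne_of_adj {i j : Fin p} (h : G.Adj i j) : i ≠ j := by
  rintro rfl
  exact G.acyclic i (.single h)

lemma not_adj_symm {i j : Fin p} (h : G.Adj i j) : ¬ G.Adj j i := fun h' =>
  G.acyclic i (.tail (.single h) h')

lemma notMem_parents_self (j : Fin p) : j ∉ G.parents j := fun h =>
  ne_of_adj (mem_parents.1 h) rfl

lemma skeleton_adj {i j : Fin p} : G.skeleton.Adj i j ↔ G.Adj i j ∨ G.Adj j i := by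
  constructor
  · exact fun h => h.2
  · exact fun h => ⟨h.elim ne_of_adj fun h => (ne_of_adj h).symm, h⟩

/-- The edge orientation is transitive wherever the end points are adjacent. -/
lemma adj_of_adj_of_adj {i j k : Fin p} (hij : G.Adj i j) (hjk : G.Adj j k)
    (hik : G.skeleton.Adj i k) : G.Adj i k :=
  (skeleton_adj.1 hik).resolve_right fun h =>
    G.acyclic i (((Relation.TransGen.single hij).tail hjk).tail h)

lemma exists_maximal_mem (s : Finset (Fin p)) (hs : s.Nonempty) :
    ∃ j ∈ s, ∀ i ∈ s, ¬ G.Adj j i := by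
  let r : Fin p → Fin p → Prop := fun i j => Relation.TransGen G.Adj j i
  have : IsTrans (Fin p) r := ⟨fun _ _ _ h h' => h'.trans h⟩
  have : Std.Irrefl r := ⟨G.acyclic⟩
  obtain ⟨j, hj, h⟩ := (Finite.wellFounded_of_trans_of_irrefl r).has_min (s : Set (Fin p)) hs
  exact ⟨j, hj, fun i hi hji => h i hi (.single hji)⟩

/-- Local Markov property: a node is separated by its parents from every non-descendant. -/
lemma dsep_parents {a b : Fin p} (hne : a ≠ b) (hba : ¬ G.Adj b a)
    (hab : ¬ Relation.TransGen G.Adj a b) : G.DSep {a} {b} (G.parents a) := by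
  intro a' ha b' hb w _
  obtain rfl := Finset.mem_singleton.1 ha
  obtain rfl := Finset.mem_singleton.1 hb
  have hpos : 0 < w.length := by
    refine Nat.pos_of_ne_zero fun h => hne ?_
    exact SimpleGraph.Walk.eq_of_length_eq_zero h
  have hedge : ∀ k < w.length, G.Adj (w.getVert k) (w.getVert (k + 1)) ∨
      G.Adj (w.getVert (k + 1)) (w.getVert k) := fun k hk =>
    skeleton_adj.1 (w.adj_getVert_succ hk)
  by_contra hblock
  -- An unblocked path is directed away from `a'`: its first edge cannot enter `a'`, and at the
  -- first reversal the collider would descend from `a'`, so a descendant of it in `G.parents a'`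
  -- would close a cycle.
  have key : ∀ k < w.length, G.Adj (w.getVert k) (w.getVert (k + 1)) ∧
      Relation.TransGen G.Adj a' (w.getVert (k + 1)) := by
    intro k
    induction k with
    | zero =>
      intro hk
      have hfirst : G.Adj (w.getVert 0) (w.getVert 1) := by
        refine (hedge 0 hk).resolve_right fun h => ?_
        rw [zero_add, w.getVert_zero] at h
        have hlen : 1 < w.length := by
          refine lt_of_le_of_ne hk fun h1 => hba ?_
          have h1 : w.getVert 1 = b' := by
            rw [show 1 = w.length from h1, w.getVert_length]
          rwa [h1] at h
        refine hblock ⟨1, one_pos, hlen, .inl ⟨fun hc => ?_, mem_parents.2 h⟩⟩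
        have := hc.1
        rw [Nat.sub_self, w.getVert_zero] at this
        exact not_adj_symm h this
      refine ⟨hfirst, ?_⟩
      rw [w.getVert_zero] at hfirst
      exact .single hfirst
    | succ k ih =>
      intro hk
      obtain ⟨h1, h2⟩ := ih (by omega)
      have hnext : G.Adj (w.getVert (k + 1)) (w.getVert (k + 1 + 1)) := by
        refine (hedge (k + 1) hk).resolve_right fun h => ?_
        refine hblock ⟨k + 1, k.succ_pos, hk, .inr ⟨⟨h1, h⟩, fun d hd hda => ?_⟩⟩
        exact G.acyclic a' ((h2.trans_left hd).tail (mem_parents.1 hda))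
      exact ⟨hnext, h2.tail hnext⟩
  have hlast := (key (w.length - 1) (by omega)).2
  rw [Nat.sub_add_cancel hpos, w.getVert_length] at hlast
  exact hab hlast

lemma DSep.symm {A B C : Finset (Fin p)} (h : G.DSep A B C) : G.DSep B A C := by
  intro b hb a ha w hw
  obtain ⟨k, hk0, hk, hcase⟩ := h a ha b hb w.reverse hw.reverse
  rw [SimpleGraph.Walk.length_reverse] at hk
  have e0 : w.reverse.getVert k = w.getVert (w.length - k) := w.getVert_reverse k
  have e1 : w.reverse.getVert (k - 1) = w.getVert (w.length - k + 1) := by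
    rw [w.getVert_reverse]; congr 1; omega
  have e2 : w.reverse.getVert (k + 1) = w.getVert (w.length - k - 1) := by
    rw [w.getVert_reverse]; congr 1
  have hcol : G.IsColliderAt w.reverse k ↔ G.IsColliderAt w (w.length - k) := by
    unfold IsColliderAt
    rw [e0, e1, e2, and_comm]
  rw [hcol, e0] at hcase
  exact ⟨w.length - k, by omega, by omega, hcase⟩

/-- Non-adjacent nodes are separated by some set containing neither of them. -/
lemma exists_dsep_of_not_adj {a b : Fin p} (hne : a ≠ b) (h : ¬ G.skeleton.Adj a b) :
    ∃ C : Finset (Fin p), a ∉ C ∧ b ∉ C ∧ G.DSep {a} {b} C := by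
  rw [skeleton_adj, not_or] at h
  by_cases hab : Relation.TransGen G.Adj a b
  · exact ⟨G.parents b, fun hm => h.1 (mem_parents.1 hm), notMem_parents_self b,
      (dsep_parents hne.symm h.1 fun hba => G.acyclic a (hab.trans hba)).symm⟩
  · exact ⟨G.parents a, notMem_parents_self a, fun hm => h.2 (mem_parents.1 hm),
      dsep_parents hne h.2 hab⟩

/-- The one-edge path has no interior node that could block it. -/
lemma not_dsep_of_adj {a b : Fin p} (h : G.skeleton.Adj a b) (C : Finset (Fin p)) :
    ¬ G.DSep {a} {b} C := by
  intro hsep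
  obtain ⟨k, h0, h1, -⟩ := hsep a (Finset.mem_singleton_self a) b (Finset.mem_singleton_self b)
    (.cons h .nil) (by simp [h.ne])
  simp at h1
  omega

/-- A separating set of the end points of an unshielded triple contains the middle node exactly
when this is not a collider. -/
lemma collider_iff_notMem {a b c : Fin p} {C : Finset (Fin p)} (hne : a ≠ b)
    (hac : G.skeleton.Adj a c) (hcb : G.skeleton.Adj c b) (hsep : G.DSep {a} {b} C) :
    (G.Adj a c ∧ G.Adj b c) ↔ c ∉ C := by
  obtain ⟨k, h0, h1, h⟩ := hsep a (Finset.mem_singleton_self a) b (Finset.mem_singleton_self b)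
    (.cons hac (.cons hcb .nil)) (by simp [hac.ne, hcb.ne, hne])
  have hk : k = 1 := by
    simp at h1
    omega
  subst hk
  have hcol : G.IsColliderAt (.cons hac (.cons hcb .nil)) 1 ↔ G.Adj a c ∧ G.Adj b c := Iff.rfl
  rw [hcol] at h
  rcases h with ⟨h, hc⟩ | ⟨h, hc⟩
  · exact iff_of_false h fun hn => hn hc
  · exact iff_of_true h (hc c .refl)

lemma MarkovEquiv.symm (h : G.MarkovEquiv G') : G'.MarkovEquiv G := Eq.symm h

lemma MarkovEquiv.dsep_iff (h : G.MarkovEquiv G') {a b : Fin p} {C : Finset (Fin p)}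
    (hne : a ≠ b) (ha : a ∉ C) (hb : b ∉ C) : G.DSep {a} {b} C ↔ G'.DSep {a} {b} C := by
  have := Set.ext_iff.1 h ({a}, {b}, C)
  simpa [CI, hne, ha, hb] using this

lemma MarkovEquiv.skeleton_le (h : G.MarkovEquiv G') : G.skeleton ≤ G'.skeleton := by
  intro a b hab
  by_contra hn
  obtain ⟨C, ha, hb, hC⟩ := exists_dsep_of_not_adj hab.ne hn
  exact not_dsep_of_adj hab C ((h.dsep_iff hab.ne ha hb).2 hC)

/-- Markov equivalent graphs have the same v-structures. -/
lemma MarkovEquiv.adj_of_vstructure (h : G.MarkovEquiv G') {a b c : Fin p} (hne : a ≠ b)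
    (hab : ¬ G.skeleton.Adj a b) (hac : G.Adj a c) (hbc : G.Adj b c) : G'.Adj a c := by
  obtain ⟨C, ha, hb, hC⟩ := exists_dsep_of_not_adj hne hab
  have h1 : G.skeleton.Adj a c := skeleton_adj.2 (.inl hac)
  have h2 : G.skeleton.Adj c b := skeleton_adj.2 (.inr hbc)
  have hc := (collider_iff_notMem hne h1 h2 hC).1 ⟨hac, hbc⟩
  exact ((collider_iff_notMem hne (h.skeleton_le h1) (h.skeleton_le h2)
    ((h.dsep_iff hne ha hb).1 hC)).2 hc).1

/-! ### Sinks and the characteristic imset -/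

/-- `j` is a node of `S` all of whose companions in `S` are parents of `j`; the existence of such
a `j` is the value at `S` of the characteristic imset of `G`. -/
def IsSinkOf (G : DAG p) (S : Finset (Fin p)) (j : Fin p) : Prop :=
  j ∈ S ∧ ∀ i ∈ S, i ≠ j → G.Adj i j

lemma IsSinkOf.unique {S : Finset (Fin p)} {i j : Fin p} (hi : G.IsSinkOf S i)
    (hj : G.IsSinkOf S j) : i = j := by
  by_contra hne
  exact not_adj_symm (hj.2 i hi.1 hne) (hi.2 j hj.1 (Ne.symm hne))

/-- The characteristic imset is an invariant of Markov equivalence. -/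
lemma MarkovEquiv.exists_isSinkOf (h : G.MarkovEquiv G') {S : Finset (Fin p)} {j : Fin p}
    (hj : G.IsSinkOf S j) : ∃ k, G'.IsSinkOf S k := by
  classical
  let K := S.filter fun k => ∀ i ∈ S, i ≠ k → G.skeleton.Adj i k
  have hjK : j ∈ K :=
    Finset.mem_filter.2 ⟨hj.1, fun i hi hne => skeleton_adj.2 (.inl (hj.2 i hi hne))⟩
  -- `K` holds the nodes of `S` adjacent to all others in `S`, the only possible sinks; the sink in
  -- `G'` is a node of `K` with no `G'`-edge into `K`.
  obtain ⟨k, hkK, hk⟩ := exists_maximal_mem (G := G') K ⟨j, hjK⟩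
  obtain ⟨hkS, hkadj⟩ := Finset.mem_filter.1 hkK
  have hadj : ∀ i ∈ S, i ≠ k → G'.skeleton.Adj i k := fun i hi hne =>
    h.skeleton_le (hkadj i hi hne)
  have hpar : ∀ i ∈ K, i ≠ k → G'.Adj i k := fun i hi hne =>
    (skeleton_adj.1 (hadj i (Finset.mem_filter.1 hi).1 hne)).resolve_right (hk i hi)
  refine ⟨k, hkS, fun i hi hne => ?_⟩
  by_cases hiK : i ∈ K
  · exact hpar i hiK hne
  -- A non-neighbour `d` of `i` makes `i → j ← d` a v-structure of `G`, so `i → j` survives in `G'`;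
  -- with `j → k`, acyclicity orients `i → k`.
  obtain ⟨d, hdS, hdi, hd⟩ : ∃ d ∈ S, d ≠ i ∧ ¬ G.skeleton.Adj d i := by
    by_contra! hall
    exact hiK (Finset.mem_filter.2 ⟨hi, hall⟩)
  have hij : i ≠ j := fun hij => hiK (hij ▸ hjK)
  have hdj : d ≠ j := by
    rintro rfl
    exact hd (skeleton_adj.2 (.inr (hj.2 i hi hij)))
  have hij' : G'.Adj i j := h.adj_of_vstructure hdi.symm (fun hn => hd hn.symm)
    (hj.2 i hi hij) (hj.2 d hdS hdj)
  by_cases hjk : j = k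
  · exact hjk ▸ hij'
  · exact adj_of_adj_of_adj hij' (hpar j hjK hjk) (hadj i hi hne)

lemma isSinkOf_insert_parents (j : Fin p) : G.IsSinkOf (insert j (G.parents j)) j :=
  ⟨Finset.mem_insert_self _ _, fun _ hi hne =>
    mem_parents.1 ((Finset.mem_insert.1 hi).resolve_left hne)⟩

lemma IsSinkOf.subset_insert_parents {S : Finset (Fin p)} {j : Fin p} (h : G.IsSinkOf S j) :
    S ⊆ insert j (G.parents j) := fun i hi =>
  Finset.mem_insert.2 (or_iff_not_imp_left.2 fun hne => mem_parents.2 (h.2 i hi hne))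

lemma isSinkOf_iff {S : Finset (Fin p)} {j : Fin p} :
    G.IsSinkOf S j ↔ S ⊆ insert j (G.parents j) ∧ ¬ S ⊆ G.parents j := by
  refine ⟨fun h => ⟨h.subset_insert_parents, fun hs => notMem_parents_self j (hs h.1)⟩, ?_⟩
  rintro ⟨h1, h2⟩
  refine ⟨?_, fun i hi hne => mem_parents.1 ((Finset.mem_insert.1 (h1 hi)).resolve_left hne)⟩
  by_contra hj
  exact h2 ((Finset.subset_insert_iff_of_notMem hj).1 h1)

end DAG

/-! ### Möbius inversion and sums of increments -/

/-- Möbius inversion on the lattice of finite sets. -/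
lemma Finset.exists_eq_sum_powerset {α M : Type*} [DecidableEq α] [AddCommGroup M]
    (f : Finset α → M) : ∃ g : Finset α → M, ∀ T, f T = ∑ S ∈ T.powerset, g S := by
  let g : Finset α → M := Finset.strongInduction fun T ih =>
    f T - ∑ S ∈ T.ssubsets.attach, ih S.1 (Finset.mem_ssubsets.1 S.2)
  refine ⟨g, fun T => ?_⟩
  have hg : g T = f T - ∑ S ∈ T.ssubsets, g S := by
    rw [← Finset.sum_attach T.ssubsets g]
    exact Finset.strongInduction_eq _ T
  have hT : T ∈ T.powerset := Finset.mem_powerset_self T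
  rw [← Finset.add_sum_erase _ _ hT, hg]
  exact (sub_add_cancel _ _).symm

namespace DAG

variable {p : ℕ} {G G' : DAG p}

open Classical in
-- The increment at `j` collects exactly the sets with sink `j`; sinks are unique, so no set is
-- counted twice.
lemma sum_insert_parents_sub (G : DAG p) (g : Finset (Fin p) → ℝ) :
    ∑ j, (∑ S ∈ (insert j (G.parents j)).powerset, g S - ∑ S ∈ (G.parents j).powerset, g S) =
      ∑ S, if ∃ j, G.IsSinkOf S j then g S else 0 := by
  have hlocal : ∀ j, ∑ S ∈ (insert j (G.parents j)).powerset, g S -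
      ∑ S ∈ (G.parents j).powerset, g S = ∑ S, if G.IsSinkOf S j then g S else 0 := by
    intro j
    rw [← Finset.sum_sdiff_eq_sub (Finset.powerset_mono.2 (Finset.subset_insert _ _)),
      ← Finset.sum_filter]
    refine Finset.sum_congr ?_ fun _ _ => rfl
    ext S
    simp [isSinkOf_iff]
  rw [Finset.sum_congr rfl fun j _ => hlocal j, Finset.sum_comm]
  refine Finset.sum_congr rfl fun S _ => ?_
  split_ifs with hS
  · obtain ⟨j, hj⟩ := hS
    rw [Finset.sum_eq_single j (fun i _ hne => if_neg fun hi => hne (hi.unique hj)) (by simp),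
      if_pos hj]
  · exact Finset.sum_eq_zero fun j _ => if_neg fun hj => hS ⟨j, hj⟩

/-- A score whose local terms are the increments of a set function takes the same value on Markov
equivalent graphs. -/
lemma MarkovEquiv.sum_increment_eq (h : G.MarkovEquiv G') (f : Finset (Fin p) → ℝ) :
    ∑ j, (f (insert j (G.parents j)) - f (G.parents j)) =
      ∑ j, (f (insert j (G'.parents j)) - f (G'.parents j)) := by
  classical
  obtain ⟨g, hg⟩ := Finset.exists_eq_sum_powerset f
  simp only [hg]
  rw [sum_insert_parents_sub, sum_insert_parents_sub]
  refine Finset.sum_congr rfl fun S _ => if_congr ?_ rfl rfl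
  exact ⟨fun ⟨_, hj⟩ => h.exists_isSinkOf hj, fun ⟨_, hj⟩ => h.symm.exists_isSinkOf hj⟩

end DAG

/-! ### Gram determinants and local scores -/

namespace EmpiricalBayes

open Matrix

variable {n p : ℕ}

/-- The Gram matrix of the columns of `X` indexed by `S`. -/
def gram (X : Matrix (Fin n) (Fin p) ℝ) (S : Finset (Fin p)) : Matrix S S ℝ :=
  (colSub X S)ᵀ * colSub X S

lemma posSemidef_gram (X : Matrix (Fin n) (Fin p) ℝ) (S : Finset (Fin p)) :
    (gram X S).PosSemidef := by
  simpa [gram] using posSemidef_conjTranspose_mul_self (colSub X S)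

lemma isUnit_gram_iff {X : Matrix (Fin n) (Fin p) ℝ} {S : Finset (Fin p)} :
    IsUnit (gram X S) ↔ 0 < (gram X S).det := by
  refine ⟨fun h => ((posSemidef_gram X S).posDef_iff_isUnit.2 h).det_pos, fun h => ?_⟩
  rw [isUnit_iff_isUnit_det]
  exact h.ne'.isUnit

lemma det_gram_pos_of_subset {X : Matrix (Fin n) (Fin p) ℝ} {S T : Finset (Fin p)} (hST : S ⊆ T)
    (hT : 0 < (gram X T).det) : 0 < (gram X S).det := by
  have hpd : (gram X T).PosDef :=
    (posSemidef_gram X T).posDef_iff_isUnit.2 (isUnit_gram_iff.2 hT)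
  have hsub := hpd.submatrix (Set.inclusion_injective hST)
  exact hsub.det_pos

/-- The residual sum of squares is the Schur complement in the Gram matrix. -/
lemma det_gram_insert {X : Matrix (Fin n) (Fin p) ℝ} {j : Fin p} {S : Finset (Fin p)}
    (hj : j ∉ S) (hS : IsUnit (gram X S)) :
    (gram X (insert j S)).det = (gram X S).det * rss X j S := by
  let e : ↥(insert j S) ≃ S ⊕ Unit :=
    (Finset.subtypeInsertEquivOption hj).trans (Equiv.optionEquivSumPUnit _)
  let B : Matrix (Fin n) Unit ℝ := X.submatrix id fun _ => j
  have hcol : colSub X (insert j S) = (fromCols (colSub X S) B).submatrix id e := by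
    ext i k
    obtain ⟨k, rfl⟩ := e.symm.surjective k
    rcases k with k | k
    · have hk : (k : Fin p) ≠ j := fun h => hj (h ▸ k.2)
      simp [colSub, e, hk, Finset.subtypeInsertEquivOption]
    · simp [colSub, e, B, Finset.subtypeInsertEquivOption]
  have hgram : gram X (insert j S) = (fromBlocks (gram X S) ((colSub X S)ᵀ * B)
      (Bᵀ * colSub X S) (Bᵀ * B)).submatrix e e := by
    rw [gram, hcol, transpose_submatrix, ← submatrix_mul _ _ _ _ _ Function.bijective_id,
      transpose_fromCols, fromRows_mul_fromCols, gram]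
  let _ := hS.invertible
  rw [hgram, det_submatrix_equiv_self, det_fromBlocks₁₁, det_unique (n := Unit),
    invOf_eq_nonsing_inv]
  congr 1
  have hrss : rss X j S = (Bᵀ * ((1 - proj X S) * B) : Matrix Unit Unit ℝ) () () := rfl
  rw [hrss, Matrix.sub_mul, Matrix.mul_sub, Matrix.one_mul, proj, gram]
  simp only [Matrix.mul_assoc]

lemma local_defined_iff {X : Matrix (Fin n) (Fin p) ℝ} {j : Fin p} {S : Finset (Fin p)}
    (hj : j ∉ S) :
    (IsUnit ((colSub X S)ᵀ * colSub X S) ∧ 0 < rss X j S) ↔ 0 < (gram X (insert j S)).det := by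
  change IsUnit (gram X S) ∧ _ ↔ _
  constructor
  · rintro ⟨hS, hr⟩
    rw [det_gram_insert hj hS]
    exact mul_pos (isUnit_gram_iff.1 hS) hr
  · intro h
    have hS := det_gram_pos_of_subset (Finset.subset_insert j S) h
    have hU := isUnit_gram_iff.2 hS
    rw [det_gram_insert hj hU] at h
    exact ⟨hU, pos_of_mul_pos_right h hS.le⟩

lemma scoreDefined_iff {X : Matrix (Fin n) (Fin p) ℝ} {G : DAG p} :
    ScoreDefined X G ↔ ∀ j, 0 < (gram X (insert j (G.parents j))).det :=
  forall_congr' fun j => local_defined_iff (DAG.notMem_parents_self j)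

/-- The set function whose increments are the local scores. -/
noncomputable def potential (K e : ℝ) (X : Matrix (Fin n) (Fin p) ℝ) (S : Finset (Fin p)) : ℝ :=
  e * Real.log (gram X S).det - (S.card.choose 2 : ℝ) * Real.log K

lemma localScore_eq_potential_sub {c₁ c₂ α γ κ : ℝ} (hc₁ : 0 < c₁) (hα : 0 < α) (hγ : 0 < γ)
    {X : Matrix (Fin n) (Fin p) ℝ} {j : Fin p} {S : Finset (Fin p)} (hj : j ∉ S)
    (h : 0 < (gram X (insert j S)).det) :
    localScore c₁ c₂ α γ κ X j S =
      potential (c₁ * (p : ℝ) ^ c₂ * √(1 + α / γ)) (-(α * n + κ) / 2) X (insert j S) -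
        potential (c₁ * (p : ℝ) ^ c₂ * √(1 + α / γ)) (-(α * n + κ) / 2) X S := by
  have hp : (0 : ℝ) < p := by exact_mod_cast j.pos
  have hK : 0 < c₁ * (p : ℝ) ^ c₂ * √(1 + α / γ) := by positivity
  obtain ⟨hU, hr⟩ := (local_defined_iff hj).2 h
  have hS : 0 < (gram X S).det := isUnit_gram_iff.1 hU
  rw [localScore, potential, potential, det_gram_insert hj hU, Finset.card_insert_of_notMem hj,
    Nat.choose_succ_succ' _ 1, Nat.choose_one_right, Real.log_mul hS.ne' hr.ne',
    Real.log_mul (zpow_pos hK _).ne' (Real.rpow_pos_of_pos hr _).ne', Real.log_zpow,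
    Real.log_rpow hr]
  -- The penalty exponent comes from `(s + 1).choose 2 - s.choose 2 = s`.
  push_cast
  ring

end EmpiricalBayes

theorem lemma3 {n p : ℕ} (c₁ c₂ α γ κ : ℝ) (hc₁ : 0 < c₁) (hc₂ : 0 ≤ c₂)
    (hα : 0 < α) (hα' : α < 1) (hγ : 0 < γ) (hκ : 0 ≤ κ)
    (X : Matrix (Fin n) (Fin p) ℝ) (G G' : DAG p) (hGG' : G.MarkovEquiv G')
    (hX : EmpiricalBayes.ScoreDefined X G) :
    EmpiricalBayes.ScoreDefined X G' ∧
      EmpiricalBayes.score c₁ c₂ α γ κ X G = EmpiricalBayes.score c₁ c₂ α γ κ X G' := by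
  have hG := EmpiricalBayes.scoreDefined_iff.1 hX
  have hG' : ∀ j, 0 < (EmpiricalBayes.gram X (insert j (G'.parents j))).det := by
    intro j
    obtain ⟨k, hk⟩ := hGG'.symm.exists_isSinkOf (DAG.isSinkOf_insert_parents (G := G') j)
    exact EmpiricalBayes.det_gram_pos_of_subset hk.subset_insert_parents (hG k)
  refine ⟨EmpiricalBayes.scoreDefined_iff.2 hG', ?_⟩
  unfold EmpiricalBayes.score
  rw [Finset.sum_congr rfl fun j _ => EmpiricalBayes.localScore_eq_potential_sub hc₁ hα hγ
      (DAG.notMem_parents_self j) (hG j),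
    Finset.sum_congr rfl fun j _ => EmpiricalBayes.localScore_eq_potential_sub hc₁ hα hγ
      (DAG.notMem_parents_self j) (hG' j)]
  exact hGG'.sum_increment_eq _
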